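/- For a ring $\Lambda$ write $\zeta(\Lambda)$ for its centre. Let $G$ be a finite group with commutator subgroup $G'$. For a field $F$ of characteristic $0$ let $\mathrm{nr} : M_n(F[G]) \to \zeta(F[G])$ denote the reduced norm. It is defined componentwise: if $F[G] \simeq \prod_{i=1}^t M_{d_i}(D_i)$ with skewfields $D_i$ and $F_i := \zeta(D_i)$, so that $\zeta(F[G]) \simeq \prod_{i=1}^t F_i$, then the $i$-th component of $\mathrm{nr}(H)$ is the reduced norm of the $i$-th component of $H$ in the central simple $F_i$-algebra $M_n(M_{d_i}(D_i))$. (a) Let $p$ be a prime, let $F$ be a (possibly infinite) field extension of $\mathbb{Q}_p$ and let $R \subset F$ be an integrally closed noetherian ring with field of fractions $F$. Then for every $n$ and every matrix $H \in M_n(R[G])$ one has $$|G'| \cdot \mathrm{nr}(H) \in \zeta(R[G]).$$ For $\mathcal{O} = \mathbb{Z}$, $F=\mathbb{Q}$ (respectively $\mathcal{O} = \mathbb{Z}_p$, $F = \mathbb{Q}_p$ for a prime $p$), let $\mathcal{I}(G)$ (respectively $\mathcal{I}_p(G)$) be the integrality ring, i.e. the $\zeta(\mathcal{O}[G])$-submodule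 of $\zeta(F[G])$ generated by all $\mathrm{nr}(H)$ with $H \in M_n(\mathcal{O}[G])$, $n \in \mathbb{N}$. Then (b) $|G'| \cdot \mathcal{I}(G) \subseteq \zeta(\mathbb{Z}[G])$; (c) $|G'| \cdot \mathcal{I}_p(G) \subseteq \zeta(\mathbb{Z}_p[G])$ for every prime $p$. -/

import Mathlib

open scoped TensorProduct
open Polynomial

universe u v w

/-! ### Reduced norms of central simple algebras -/

/-- `c : K` is the reduced norm of the element `b` of the central simple `K`-algebra `B`:
for a splitting field `E` of `B` and an isomorphism `h : E ⊗ B ≃ M_m(E)` of `E`-algebras, one has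
`c = det (h (1 ⊗ b))`. The zero ring is admitted for `B` (then `m = 0` and `c = 1`). -/
def IsReducedNorm (K : Type u) (B : Type v) [Field K] [Ring B] [Algebra K B] (b : B) (c : K) :
    Prop :=
  ∃ (E : Type u) (_ : Field E) (_ : Algebra K E) (m : ℕ)
    (h : E ⊗[K] B ≃ₐ[E] Matrix (Fin m) (Fin m) E),
    (h (1 ⊗ₜ[K] b)).det = algebraMap K E c

/-- The reduced norm `B → K` of a central simple `K`-algebra `B` (see `existsUnique_isReducedNorm`
and `det_eq_csaReducedNorm` for existence and independence of the choices). -/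
noncomputable def csaReducedNorm (K : Type u) (B : Type v) [Field K] [Ring B] [Algebra K B]
    (b : B) : K :=
  Classical.epsilon (IsReducedNorm K B b)

/-- For a central simple algebra `B`, every `K`-linear endomorphism of `B` is a sum of maps
`x ↦ a x b`. -/
theorem exists_tensor_smul_eq {K : Type u} {B : Type v} [Field K] [Ring B] [Algebra K B]
    [IsSimpleRing B] [Algebra.IsCentral K B] [FiniteDimensional K B] (f : B →ₗ[K] B) :
    ∃ r : B ⊗[K] Bᵐᵒᵖ, f = AlgHom.mulLeftRight K B r := by
  let : Module (B ⊗[K] Bᵐᵒᵖ) B := Module.compHom B (AlgHom.mulLeftRight K B).toRingHom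
  have smul_def (r : B ⊗[K] Bᵐᵒᵖ) (x : B) : r • x = AlgHom.mulLeftRight K B r x := rfl
  have smul_tmul (a : B) (b : Bᵐᵒᵖ) (x : B) : (a ⊗ₜ[K] b) • x = a * x * b.unop := by
    rw [smul_def, AlgHom.mulLeftRight_apply]
  have hsimple : IsSimpleModule (B ⊗[K] Bᵐᵒᵖ) B := by
    rw [isSimpleModule_iff]
    refine { exists_pair_ne := ⟨⊥, ⊤, bot_ne_top⟩, eq_bot_or_eq_top := fun N => ?_ }
    by_cases hN : N = ⊥
    · exact Or.inl hN
    refine Or.inr ?_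
    obtain ⟨x, hxN, hx0⟩ := N.exists_mem_ne_zero_of_ne_bot hN
    let I : TwoSidedIdeal B := TwoSidedIdeal.mk' (N : Set B) N.zero_mem N.add_mem
      (fun h => N.neg_mem h)
      (fun {a y} h => by simpa [smul_tmul] using N.smul_mem (a ⊗ₜ[K] (1 : Bᵐᵒᵖ)) h)
      (fun {y a} h => by
        simpa [smul_tmul] using N.smul_mem ((1 : B) ⊗ₜ[K] (MulOpposite.op a)) h)
    have hmem (y : B) : y ∈ I ↔ y ∈ N := TwoSidedIdeal.mem_mk' ..
    have h1 : (1 : B) ∈ N := (hmem 1).1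
      (IsSimpleRing.one_mem_of_ne_zero_mem I hx0 ((hmem x).2 hxN))
    rw [eq_top_iff]
    intro y _
    simpa [smul_tmul] using N.smul_mem (y ⊗ₜ[K] (1 : Bᵐᵒᵖ)) h1
  have hscalar (φ : Module.End (B ⊗[K] Bᵐᵒᵖ) B) : ∃ k : K, ∀ x, φ x = k • x := by
    have hl (x : B) : φ x = x * φ 1 := by
      simpa [smul_tmul] using φ.map_smul (x ⊗ₜ[K] (1 : Bᵐᵒᵖ)) 1
    have hr (x : B) : φ x = φ 1 * x := by
      simpa [smul_tmul] using φ.map_smul ((1 : B) ⊗ₜ[K] (MulOpposite.op x)) 1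
    have hc : φ 1 ∈ Subalgebra.center K B :=
      Subalgebra.mem_center_iff.2 fun b => by rw [← hl, ← hr]
    rw [Algebra.IsCentral.center_eq_bot, Algebra.mem_bot] at hc
    obtain ⟨k, hk⟩ := hc
    exact ⟨k, fun x => by rw [hr, ← hk, Algebra.smul_def]⟩
  let g : Module.End (Module.End (B ⊗[K] Bᵐᵒᵖ) B) B :=
    { toFun := f
      map_add' := f.map_add
      map_smul' := fun φ x => by
        obtain ⟨k, hk⟩ := hscalar φ
        simp [Module.End.smul_def, hk] }
  obtain ⟨s, hs⟩ := (Module.Finite.fg_top (R := K) (M := B))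
  obtain ⟨r, hr⟩ := jacobson_density g s
  refine ⟨r, ?_⟩
  refine LinearMap.ext_on hs fun m hm => ?_
  exact hr m hm

/-- Scalar extensions of central simple algebras are simple. -/
theorem isSimpleRing_baseChange (K : Type u) (B : Type v) (E : Type w) [Field K] [Ring B]
    [Algebra K B] [IsSimpleRing B] [Algebra.IsCentral K B] [FiniteDimensional K B]
    [Field E] [Algebra K E] : IsSimpleRing (E ⊗[K] B) := by
  refine ⟨{ exists_pair_ne := ⟨⊥, ⊤, bot_ne_top⟩, eq_bot_or_eq_top := fun I => ?_ }⟩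
  by_cases hI : I = ⊥
  · exact Or.inl hI
  refine Or.inr ?_
  obtain ⟨w, hwI, hw0⟩ : ∃ w ∈ I, w ≠ 0 := by
    by_contra! h
    exact hI (eq_bot_iff.2 fun x hx => by simpa using h x hx)
  have key (r : B ⊗[K] Bᵐᵒᵖ) : (AlgHom.mulLeftRight K B r).baseChange E w ∈ I := by
    induction r using TensorProduct.induction_on with
    | zero => simp
    | add r s hr hs => simpa [LinearMap.baseChange_add] using I.add_mem hr hs
    | tmul a b =>
      have h (z : E ⊗[K] B) : (AlgHom.mulLeftRight K B (a ⊗ₜ b)).baseChange E z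
          = (1 ⊗ₜ[K] a) * z * (1 ⊗ₜ[K] b.unop) := by
        induction z using TensorProduct.induction_on with
        | zero => simp
        | add x y hx hy => rw [map_add, hx, hy, mul_add, add_mul]
        | tmul e x => simp [AlgHom.mulLeftRight_apply]
      rw [h]
      exact I.mul_mem_right _ _ (I.mul_mem_left _ _ hwI)
  let b := Module.finBasis K B
  let b' := Algebra.TensorProduct.basis E b
  obtain ⟨i, hi⟩ : ∃ i, b'.repr w i ≠ 0 := by
    by_contra! h
    exact hw0 (b'.ext_elem fun i => by simpa using h i)
  obtain ⟨r, hr⟩ := exists_tensor_smul_eq (b.constr K (fun j => if j = i then (1 : B) else 0))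
  have h1 := key r
  rw [← hr] at h1
  have h2 : (b.constr K (fun j => if j = i then (1 : B) else 0)).baseChange E w
      = (b'.repr w i) ⊗ₜ[K] (1 : B) := by
    conv_lhs => rw [← b'.sum_repr w]
    simp [b', map_sum, TensorProduct.tmul_ite, TensorProduct.smul_tmul']
    trace_state
  rw [h2] at h1
  have h3 : (1 : E ⊗[K] B) ∈ I := by
    have := I.mul_mem_left ((b'.repr w i)⁻¹ ⊗ₜ[K] (1 : B)) _ h1
    simpa [hi, Algebra.TensorProduct.one_def] using this
  rw [eq_top_iff]
  intro x _
  simpa using I.mul_mem_left x _ h3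

/-- Left multiplication by an `m × m` matrix `M` has characteristic polynomial `χ_M ^ m`. -/
theorem charpoly_lmul_matrix {E : Type u} [Field E] {m : ℕ} (M : Matrix (Fin m) (Fin m) E) :
    (Algebra.lmul E (Matrix (Fin m) (Fin m) E) M).charpoly = M.charpoly ^ m := by
  have h : LinearMap.toMatrix (Matrix.stdBasis E (Fin m) (Fin m))
      (Matrix.stdBasis E (Fin m) (Fin m)) (Algebra.lmul E (Matrix (Fin m) (Fin m) E) M) =
      Matrix.kronecker M (1 : Matrix (Fin m) (Fin m) E) := by
    ext ⟨i, j⟩ ⟨k, l⟩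
    rw [LinearMap.toMatrix_apply]
    have hs (x : Fin m) : (Pi.single k (Pi.single l 1) : Fin m → Fin m → E) x j =
        if x = k then (if j = l then 1 else 0) else 0 := by
      by_cases hx : x = k
      · subst hx; simp [Pi.single_apply]
      · simp [hx]
    simp [Matrix.stdBasis, Matrix.one_apply, Matrix.mul_apply, hs]
  rw [← LinearMap.charpoly_toMatrix _ (Matrix.stdBasis E (Fin m) (Fin m)), h, Matrix.charpoly]
  have h2 : (Matrix.kronecker M (1 : Matrix (Fin m) (Fin m) E)).charmatrix
      = Matrix.kronecker M.charmatrix (1 : Matrix (Fin m) (Fin m) E[X]) := by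
    ext ⟨i, j⟩ ⟨k, l⟩
    by_cases hik : i = k <;> by_cases hjl : j = l <;>
    simp [hik, hjl]
  rw [h2, Matrix.kronecker, Matrix.det_kronecker]
  simp [Matrix.charpoly]

theorem monic_pow_injective {E : Type u} [Field E] {m : ℕ} (hm : m ≠ 0) {p q : E[X]}
    (hp : p.Monic) (hq : q.Monic) (h : p ^ m = q ^ m) : p = q := by
  refine eq_of_monic_of_associated hp hq (associated_of_dvd_dvd ?_ ?_)
  · exact (IsIntegrallyClosed.pow_dvd_pow_iff hm).1 h.dvd
  · exact (IsIntegrallyClosed.pow_dvd_pow_iff hm).1 h.symm.dvd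

theorem charpoly_split_pow {K : Type u} {B : Type v} [Field K] [Ring B] [Algebra K B]
    [FiniteDimensional K B] {E : Type w} [Field E] [Algebra K E] {m : ℕ}
    (h : E ⊗[K] B ≃ₐ[E] Matrix (Fin m) (Fin m) E) (b : B) :
    (h (1 ⊗ₜ b)).charpoly ^ m = (Algebra.lmul K B b).charpoly.map (algebraMap K E) := by
  rw [← charpoly_lmul_matrix, ← LinearMap.charpoly_baseChange, Algebra.baseChange_lmul,
    ← LinearEquiv.charpoly_conj h.toLinearEquiv]
  congr 1
  ext x : 1
  simp [LinearEquiv.conj_apply]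

/-- The characteristic polynomial of `h (1 ⊗ b)` has coefficients in `K`. -/
theorem exists_charpoly_descent {K : Type u} {B : Type v} [Field K] [CharZero K] [Ring B]
    [Algebra K B] [FiniteDimensional K B] {m : ℕ}
    (h : AlgebraicClosure K ⊗[K] B ≃ₐ[AlgebraicClosure K]
      Matrix (Fin m) (Fin m) (AlgebraicClosure K)) (b : B) :
    ∃ p : K[X], p.Monic ∧ p.map (algebraMap K (AlgebraicClosure K)) = (h (1 ⊗ₜ b)).charpoly := by
  have hmon := (h (1 ⊗ₜ b)).charpoly_monic
  rcases Nat.eq_zero_or_pos m with rfl | hm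
  · exact ⟨1, monic_one, by simp [Matrix.charpoly]⟩
  suffices hl : (h (1 ⊗ₜ b)).charpoly ∈ lifts (algebraMap K (AlgebraicClosure K)) by
    obtain ⟨p, hp, -, hp'⟩ := lifts_and_natDegree_eq_and_monic hl hmon
    exact ⟨p, hp', hp⟩
  rw [lifts_iff_coeff_lifts]
  intro n
  have : IsGalois K (AlgebraicClosure K) := {}
  have := (InfiniteGalois.mem_bot_iff_fixed (k := K) ((h (1 ⊗ₜ b)).charpoly.coeff n)).2 ?_
  · rw [IntermediateField.mem_bot] at this
    exact this
  intro σ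
  have hσ : (h (1 ⊗ₜ b)).charpoly.map (σ : AlgebraicClosure K →+* AlgebraicClosure K)
      = (h (1 ⊗ₜ b)).charpoly := by
    refine monic_pow_injective hm.ne' (hmon.map _) hmon ?_
    rw [← Polynomial.map_pow, charpoly_split_pow, Polynomial.map_map]
    congr 1
    ext x
    simp
  simpa using congrArg (fun q => q.coeff n) hσ

/-- `B` becomes a matrix algebra over the algebraic closure of `K`. -/
def IsSplitByClosure (K : Type u) (B : Type v) [Field K] [Ring B] [Algebra K B] : Prop :=
  ∃ m : ℕ, Nonempty (AlgebraicClosure K ⊗[K] B ≃ₐ[AlgebraicClosure K]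
    Matrix (Fin m) (Fin m) (AlgebraicClosure K))

theorem isSplitByClosure_of_isSimpleRing (K : Type u) (B : Type v) [Field K] [Ring B]
    [Algebra K B] [IsSimpleRing B] [Algebra.IsCentral K B] [FiniteDimensional K B] :
    IsSplitByClosure K B := by
  have := isSimpleRing_baseChange K B (AlgebraicClosure K)
  obtain ⟨m, -, h⟩ := IsSimpleRing.exists_algEquiv_matrix_of_isAlgClosed (AlgebraicClosure K)
    (AlgebraicClosure K ⊗[K] B)
  exact ⟨m, h⟩

theorem isSplitByClosure_of_subsingleton (K : Type u) (B : Type v) [Field K] [Ring B]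
    [Algebra K B] [Subsingleton B] : IsSplitByClosure K B := by
  have : Subsingleton (AlgebraicClosure K ⊗[K] B) := by
    refine subsingleton_of_zero_eq_one ?_
    rw [Algebra.TensorProduct.one_def, Subsingleton.elim (1 : B) 0, TensorProduct.tmul_zero]
  exact ⟨0, ⟨{ toFun := 0, invFun := 0, left_inv := fun _ => Subsingleton.elim _ _,
               right_inv := fun _ => Subsingleton.elim _ _,
               map_mul' := fun _ _ => Subsingleton.elim _ _,
               map_add' := fun _ _ => Subsingleton.elim _ _,
               commutes' := fun _ => Subsingleton.elim _ _ }⟩⟩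

/-- There is a single `c : K` that is computed by all splitting fields and all isomorphisms. -/
theorem exists_forall_det_eq {K : Type u} {B : Type v} [Field K] [CharZero K] [Ring B]
    [Algebra K B] [FiniteDimensional K B] (hB : IsSplitByClosure K B) (b : B) :
    ∃ c : K, ∀ (E : Type w) [Field E] [Algebra K E] (m : ℕ)
      (h : E ⊗[K] B ≃ₐ[E] Matrix (Fin m) (Fin m) E),
      (h (1 ⊗ₜ[K] b)).det = algebraMap K E c := by
  obtain ⟨m, ⟨h⟩⟩ := hB
  obtain ⟨p, hp, hp'⟩ := exists_charpoly_descent h b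
  refine ⟨(-1) ^ m * p.coeff 0, fun E _ _ m' h' => ?_⟩
  have hdim : m * m = Module.finrank K B := by
    have := h.toLinearEquiv.finrank_eq
    simpa [Module.finrank_matrix, Module.finrank_baseChange] using this.symm
  have hdim' : m' * m' = Module.finrank K B := by
    have := h'.toLinearEquiv.finrank_eq
    simpa [Module.finrank_matrix, Module.finrank_baseChange] using this.symm
  obtain rfl : m = m' := Nat.mul_self_inj.1 (hdim.trans hdim'.symm)
  have hpow : p ^ m = (Algebra.lmul K B b).charpoly := by
    apply Polynomial.map_injective (algebraMap K (AlgebraicClosure K))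
      (algebraMap K (AlgebraicClosure K)).injective
    rw [Polynomial.map_pow, hp', charpoly_split_pow]
  have hp2 : p.map (algebraMap K E) = (h' (1 ⊗ₜ b)).charpoly := by
    rcases Nat.eq_zero_or_pos m with rfl | hm
    · have : p.map (algebraMap K (AlgebraicClosure K)) =
          (1 : K[X]).map (algebraMap K (AlgebraicClosure K)) := by
        rw [hp']; simp [Matrix.charpoly]
      rw [Polynomial.map_injective _ (algebraMap K (AlgebraicClosure K)).injective this]
      simp [Matrix.charpoly]
    · refine monic_pow_injective hm.ne' (hp.map _) (Matrix.charpoly_monic _) ?_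
      rw [← Polynomial.map_pow, hpow, charpoly_split_pow]
  rw [Matrix.det_eq_sign_charpoly_coeff, ← hp2]
  simp

/-- Existence and uniqueness of reduced norms. -/
theorem existsUnique_isReducedNorm {K : Type u} {B : Type v} [Field K] [CharZero K] [Ring B]
    [Algebra K B] [FiniteDimensional K B] (hB : IsSplitByClosure K B) (b : B) :
    ∃! c : K, IsReducedNorm K B b c := by
  obtain ⟨c, hc⟩ := exists_forall_det_eq.{u, v, u} hB b
  obtain ⟨m, ⟨h⟩⟩ := hB
  refine ⟨c, ⟨_, _, _, m, h, hc _ m h⟩, ?_⟩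
  rintro c' ⟨E, _, _, m', h', hc'⟩
  exact (algebraMap K E).injective (hc'.symm.trans (hc E m' h'))

theorem csaReducedNorm_spec {K : Type u} {B : Type v} [Field K] [CharZero K] [Ring B]
    [Algebra K B] [FiniteDimensional K B] (hB : IsSplitByClosure K B) (b : B) :
    IsReducedNorm K B b (csaReducedNorm K B b) :=
  Classical.epsilon_spec (existsUnique_isReducedNorm hB b).exists

/-- The reduced norm can be computed from any splitting field and any isomorphism. -/
theorem det_eq_csaReducedNorm {K : Type u} {B : Type v} [Field K] [CharZero K] [Ring B]
    [Algebra K B] [FiniteDimensional K B] (hB : IsSplitByClosure K B) (b : B)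
    (E : Type u) [Field E] [Algebra K E] {m : ℕ}
    (h : E ⊗[K] B ≃ₐ[E] Matrix (Fin m) (Fin m) E) :
    (h (1 ⊗ₜ[K] b)).det = algebraMap K E (csaReducedNorm K B b) := by
  obtain ⟨c, hc⟩ := exists_forall_det_eq.{u, v, u} hB b
  rw [hc E m h, (existsUnique_isReducedNorm hB b).unique (csaReducedNorm_spec hB b)
    ⟨E, _, _, m, h, hc E m h⟩]

/-! ### Reduced norms of separable algebras -/

/-- A decomposition `A ≃ ∏ i, M_{d_i}(D_i)` of an `F`-algebra `A` with skewfields `D_i`. -/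
structure WedderburnDecomposition (F : Type u) (A : Type v) [Field F] [Ring A] [Algebra F A] where
  /-- the number of simple components -/
  t : ℕ
  /-- the skewfields -/
  D : Fin t → Type v
  [divisionRing : ∀ i, DivisionRing (D i)]
  [algebra : ∀ i, Algebra F (D i)]
  /-- the sizes of the matrix rings -/
  d : Fin t → ℕ
  d_ne_zero : ∀ i, d i ≠ 0
  /-- the isomorphism -/
  equiv : A ≃ₐ[F] ((i : Fin t) → Matrix (Fin (d i)) (Fin (d i)) (D i))

namespace WedderburnDecomposition

attribute [instance] divisionRing algebra

theorem nonempty (F : Type u) (A : Type v) [Field F] [Ring A] [Algebra F A]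
    [IsSemisimpleRing A] [FiniteDimensional F A] : Nonempty (WedderburnDecomposition F A) := by
  obtain ⟨t, D, d, _, _, hd, ⟨e⟩⟩ := IsSemisimpleRing.exists_algEquiv_pi_matrix_divisionRing F A
  exact ⟨{ t := t, D := D, d := d, d_ne_zero := fun i => (hd i).ne, equiv := e }⟩

variable {F : Type u} {A : Type v} [Field F] [Ring A] [Algebra F A]

/-- The component of `H ∈ M_n(A)` in `M_n(M_{d_i}(D_i))`. -/
def component (W : WedderburnDecomposition F A) {n : ℕ} (H : Matrix (Fin n) (Fin n) A)
    (i : Fin W.t) : Matrix (Fin n) (Fin n) (Matrix (Fin (W.d i)) (Fin (W.d i)) (W.D i)) :=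
  H.map fun a => W.equiv a i

/-- The `i`-th component, in the field `F_i = ζ(D_i)`, of the reduced norm of `H ∈ M_n(A)`: the
reduced norm of the component of `H` in the central simple `F_i`-algebra `M_n(M_{d_i}(D_i))`. -/
noncomputable def componentNorm (W : WedderburnDecomposition F A) {n : ℕ}
    (H : Matrix (Fin n) (Fin n) A) (i : Fin W.t) : Subring.center (W.D i) :=
  csaReducedNorm (Subring.center (W.D i))
    (Matrix (Fin n) (Fin n) (Matrix (Fin (W.d i)) (Fin (W.d i)) (W.D i))) (W.component H i)

/-- The reduced norm `M_n(A) → ζ(A) = ∏ i, F_i`, where `F_i = ζ(D_i)` is embedded into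
`M_{d_i}(D_i)` as scalar matrices. -/
noncomputable def reducedNorm (W : WedderburnDecomposition F A) {n : ℕ}
    (H : Matrix (Fin n) (Fin n) A) : Subring.center A :=
  ⟨W.equiv.symm fun i => Matrix.scalar (Fin (W.d i)) (W.componentNorm H i : W.D i), by
    rw [Subring.mem_center_iff]
    intro a
    apply W.equiv.injective
    rw [map_mul, map_mul, AlgEquiv.apply_symm_apply]
    funext i
    exact (Matrix.scalar_commute _
      (fun r => (Subring.mem_center_iff.1 (W.componentNorm H i).2 r).symm) _).symm⟩

/-- The components of the reduced norm are well defined. -/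
theorem existsUnique_component [CharZero F] [FiniteDimensional F A]
    (W : WedderburnDecomposition F A) {n : ℕ} (H : Matrix (Fin n) (Fin n) A) (i : Fin W.t) :
    IsReducedNorm (Subring.center (W.D i)) _ (W.component H i) (W.componentNorm H i) ∧
      ∀ c, IsReducedNorm (Subring.center (W.D i)) _ (W.component H i) c →
        c = W.componentNorm H i := by
  have : NeZero (W.d i) := ⟨W.d_ne_zero i⟩
  have hfin : Module.Finite F (W.D i) := by
    let f : A →ₗ[F] W.D i := (Matrix.entryLinearMap F (W.D i) 0 0) ∘ₗ
      (LinearMap.proj (φ := fun i => Matrix (Fin (W.d i)) (Fin (W.d i)) (W.D i)) i) ∘ₗ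
      W.equiv.toLinearMap
    refine Module.Finite.of_surjective f fun x => ?_
    exact ⟨W.equiv.symm (Pi.single i (Matrix.of fun _ _ => x)), by simp [f]⟩
  let g : F →+* Subring.center (W.D i) := (algebraMap F (W.D i)).codRestrict _ fun x =>
    Subring.mem_center_iff.2 fun y => (Algebra.commutes x y).symm
  let : Algebra F (Subring.center (W.D i)) := g.toAlgebra
  have : IsScalarTower F (Subring.center (W.D i)) (W.D i) := IsScalarTower.of_algebraMap_eq'  rfl
  have : Module.Finite (Subring.center (W.D i)) (W.D i) :=
    Module.Finite.of_restrictScalars_finite F _ _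
  have : CharZero (Subring.center (W.D i)) := charZero_of_injective_algebraMap g.injective
  have : Algebra.IsCentral (Subring.center (W.D i)) (W.D i) :=
    ⟨fun x hx => Algebra.mem_bot.2 ⟨⟨x, hx⟩, rfl⟩⟩
  have hs : IsSplitByClosure (Subring.center (W.D i))
      (Matrix (Fin n) (Fin n) (Matrix (Fin (W.d i)) (Fin (W.d i)) (W.D i))) := by
    rcases Nat.eq_zero_or_pos n with rfl | hn
    · exact isSplitByClosure_of_subsingleton _ _
    · have : NeZero n := ⟨hn.ne'⟩
      exact isSplitByClosure_of_isSimpleRing _ _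
  have h := csaReducedNorm_spec hs (W.component H i)
  exact ⟨h, fun c hc => (existsUnique_isReducedNorm hs (W.component H i)).unique hc h⟩

end WedderburnDecomposition

/-- The reduced norm `nr : M_n(A) → ζ(A)` of a finite dimensional semisimple `F`-algebra `A`. -/
noncomputable def reducedNorm (F : Type u) {A : Type v} [Field F] [Ring A] [Algebra F A]
    [IsSemisimpleRing A] [FiniteDimensional F A] {n : ℕ} (H : Matrix (Fin n) (Fin n) A) :
    Subring.center A :=
  (WedderburnDecomposition.nonempty F A).some.reducedNorm H

/-! ### Group rings -/

section GroupRing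

variable (R : Type v) (F : Type u) (G : Type w) [CommRing R] [Field F] [Algebra R F] [Group G]

/-- The embedding `R[G] → F[G]`, for `R` a domain with field of fractions `F`. -/
noncomputable def groupRingMap : MonoidAlgebra R G →+* MonoidAlgebra F G :=
  MonoidAlgebra.mapRingHom G (algebraMap R F)

/-- The centre `ζ(R[G])`, as a subring of `F[G]`. -/
noncomputable def groupRingCenter : Subring (MonoidAlgebra F G) :=
  (Subring.center (MonoidAlgebra R G)).map (groupRingMap R F G)

variable {R G} [CharZero F] [Finite G]

/-- The reduced norm `nr(H) ∈ ζ(F[G])` of a square matrix `H` with entries in `R[G]`. -/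
noncomputable def groupRingNorm {n : ℕ} (H : Matrix (Fin n) (Fin n) (MonoidAlgebra R G)) :
    Subring.center (MonoidAlgebra F G) :=
  reducedNorm F (H.map (groupRingMap R F G))

variable (R G)

/-- The integrality ring of `R[G]`: the `ζ(R[G])`-submodule of `ζ(F[G])`, here viewed inside
`F[G]`, that is generated by the reduced norms of all square matrices over `R[G]`. -/
noncomputable def integralityRing : Submodule (groupRingCenter R F G) (MonoidAlgebra F G) :=
  Submodule.span (groupRingCenter R F G)
    {x | ∃ (n : ℕ) (H : Matrix (Fin n) (Fin n) (MonoidAlgebra R G)), x = groupRingNorm F H}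

end GroupRing

/-!
The reduced norm `z = nr(H) ∈ ζ(F[G])` is first described by representations: if `L` is a field
containing `F` and `ρ : G → GL_k(L)` is absolutely irreducible (its image spans `M_k(L)`), then
`ρ(z)` is the scalar matrix `det ρ(H)` (`WedderburnDecomposition.map_reducedNorm`).

Let `g ∈ G`, let `z_g` be the part of `z` supported on the coset `g G'`, and put
`y = g⁻¹ z_g ∈ F[G']`. Left multiplication by `y` on `L[G']` has trace `|G'|` times the coefficient
of `z` at `g` (`MonoidAlgebra.trace_lmul`), so it suffices that its eigenvalues are integral over
`R`. As `g` has finite order, this follows once `z_g` acts as an integral scalar in each absolutely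
irreducible representation `ρ` over an algebraically closed field `L ⊇ F`.

To see the latter, twist `ρ` by the tautological character `G → L[G/G']ˣ`. The twist `Δ` still
satisfies `Δ(z) = det Δ(H)`, because each homomorphism `L[G/G'] → L` turns `Δ` into a twist of `ρ`
by a linear character, which is absolutely irreducible again
(`lift_twistByAbelianization_reducedNorm`). Comparing coefficients at the class of `g`, one sees
that `ρ(z_g)` is the scalar given by that coefficient of `det Δ(H) ∈ L[G/G']`. This coefficient lies
in each valuation ring `V ⊇ R` of `L`, since `ρ` can be conjugated into `M_k(V)`
(`exists_conj_forall_mem_valuationSubring`); hence it is integral over `R`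
(`exists_isIntegral_sum_groupRingNorm_eq_scalar`).

The argument works over every integrally closed `R` with field of fractions `F` of
characteristic `0`, so the same lemma covers `ℤ`, `ℤ_p` and the extensions of `ℚ_p`.
-/

open scoped Matrix

/-! ### Reduced norms and representations that span a matrix algebra -/

theorem Matrix.exists_eq_scalar_of_commute_of_span_eq_top {E : Type*} [Field E] {ι : Type*}
    [Fintype ι] [DecidableEq ι] {s : Set (Matrix ι ι E)} (hs : Submodule.span E s = ⊤)
    {M : Matrix ι ι E} (hM : ∀ x ∈ s, Commute x M) : ∃ c : E, M = Matrix.scalar ι c := by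
  have hcomm (x : Matrix ι ι E) : Commute x M := by
    have hx : x ∈ Submodule.span E s := hs ▸ Submodule.mem_top
    induction hx using Submodule.span_induction with
    | mem x hx => exact hM x hx
    | zero => exact Commute.zero_left M
    | add x y _ _ hx hy => exact hx.add_left hy
    | smul a x _ hx => exact hx.smul_left a
  obtain ⟨c, hc⟩ := Matrix.mem_range_scalar_of_commute_single (M := M)
    fun i j _ => hcomm _
  exact ⟨c, hc.symm⟩

theorem Matrix.span_range_comp_map_eq_top {S E : Type*} [Ring S] [Field E] {ι : Type*}
    [Fintype ι] [DecidableEq ι] (σ : S →+* Matrix ι ι E)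
    (hσ : Submodule.span E (Set.range σ) = ⊤) (n : ℕ) :
    Submodule.span E (Set.range fun N : Matrix (Fin n) (Fin n) S =>
      Matrix.comp (Fin n) (Fin n) ι ι E (N.map σ)) = ⊤ := by
  rw [eq_top_iff]
  rintro M -
  have hM : M = ∑ i, ∑ j, Matrix.comp (Fin n) (Fin n) ι ι E
      (Matrix.single i j ((Matrix.comp (Fin n) (Fin n) ι ι E).symm M i j)) := by
    have := congrArg (Matrix.comp (Fin n) (Fin n) ι ι E)
      (Matrix.matrix_eq_sum_single ((Matrix.comp (Fin n) (Fin n) ι ι E).symm M))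
    rw [Equiv.apply_symm_apply] at this
    refine this.trans ?_
    change Matrix.compAddEquiv (Fin n) (Fin n) ι ι E _ = _
    simp only [map_sum]
    rfl
  rw [hM]
  refine Submodule.sum_mem _ fun i _ => Submodule.sum_mem _ fun j _ => ?_
  generalize (Matrix.comp (Fin n) (Fin n) ι ι E).symm M i j = y
  have hy : y ∈ Submodule.span E (Set.range σ) := hσ ▸ Submodule.mem_top
  let f : Matrix ι ι E →ₗ[E] Matrix (Fin n × ι) (Fin n × ι) E :=
    { toFun := fun y => Matrix.comp (Fin n) (Fin n) ι ι E (Matrix.single i j y)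
      map_add' := fun x y => by rw [Matrix.single_add]; rfl
      map_smul' := fun a x => by
        rw [← Matrix.smul_single]; rfl }
  have h2 := Submodule.mem_map_of_mem (f := f) hy
  rw [Submodule.map_span] at h2
  refine Submodule.span_mono ?_ h2
  rintro _ ⟨_, ⟨s, rfl⟩, rfl⟩
  refine ⟨Matrix.single i j s, ?_⟩
  change Matrix.comp _ _ _ _ _ _ = Matrix.comp _ _ _ _ _ _
  rw [Matrix.map_single]

/-- A representation `σ` of a central simple algebra `S` over a field `E` whose image spans the
full matrix algebra computes reduced norms of matrices over `S`. The field `E` is regarded as an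
extension of the centre `K` of `S` through `σ`, and `E ⊗ M_n(S)` is then split by `σ`. -/
theorem map_algebraMap_csaReducedNorm {K S E : Type v} [Field K] [CharZero K] [Ring S]
    [Algebra K S] [IsSimpleRing S] [Algebra.IsCentral K S] [FiniteDimensional K S] [Field E]
    {ι : Type*} [Fintype ι] [DecidableEq ι] [Nonempty ι] (σ : S →+* Matrix ι ι E)
    (hσ : Submodule.span E (Set.range σ) = ⊤) {n : ℕ} (N : Matrix (Fin n) (Fin n) S) :
    σ (algebraMap K S (csaReducedNorm K (Matrix (Fin n) (Fin n) S) N)) =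
      Matrix.scalar ι (Matrix.comp (Fin n) (Fin n) ι ι E (N.map σ)).det := by
  have hscalar (c : K) : ∃ e : E, σ (algebraMap K S c) = Matrix.scalar ι e := by
    refine Matrix.exists_eq_scalar_of_commute_of_span_eq_top hσ ?_
    rintro _ ⟨s, rfl⟩
    exact (Algebra.commute_algebraMap_right c s).map σ
  -- `τ` makes `E` an extension of `K`.
  choose τ hτ using hscalar
  have hinj : Function.Injective (Matrix.scalar (α := E) ι) := fun _ _ => Matrix.scalar_inj.1
  let τ' : K →+* E :=
    { toFun := τ
      map_one' := hinj (by rw [← hτ]; simp)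
      map_mul' := fun x y => hinj (by rw [← hτ]; simp [hτ])
      map_zero' := hinj (by rw [← hτ]; simp)
      map_add' := fun x y => hinj (by rw [← hτ, map_add, map_add, map_add, ← hτ, ← hτ]) }
  let : Algebra K E := τ'.toAlgebra
  have halg (c : K) : algebraMap K E c = τ c := rfl
  have hσK (c : K) : σ (algebraMap K S c) = algebraMap K (Matrix ι ι E) c := by
    rw [hτ, ← halg]; rfl
  let σK : S →ₐ[K] Matrix ι ι E := { σ with commutes' := hσK }
  let e : Fin (Fintype.card (Fin n × ι)) ≃ Fin n × ι := (Fintype.equivFin _).symm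
  let φ : Matrix (Fin n) (Fin n) S →ₐ[K]
      Matrix (Fin (Fintype.card (Fin n × ι))) (Fin (Fintype.card (Fin n × ι))) E :=
    ((Matrix.reindexAlgEquiv K E e.symm).toAlgHom.comp
      (Matrix.compAlgEquiv (Fin n) ι E K).toAlgHom).comp σK.mapMatrix
  have hφ (N : Matrix (Fin n) (Fin n) S) :
      φ N = Matrix.reindex e.symm e.symm (Matrix.comp (Fin n) (Fin n) ι ι E (N.map σ)) := rfl
  let Ψ : E ⊗[K] Matrix (Fin n) (Fin n) S →ₐ[E]
      Matrix (Fin (Fintype.card (Fin n × ι))) (Fin (Fintype.card (Fin n × ι))) E :=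
    Algebra.TensorProduct.lift (Algebra.ofId E _) φ fun x y => Algebra.commutes x (φ y)
  have hΨ (x : E) (N : Matrix (Fin n) (Fin n) S) : Ψ (x ⊗ₜ N) = x • φ N := by
    rw [Algebra.smul_def]
    exact Algebra.TensorProduct.lift_tmul ..
  have hsurj : Function.Surjective Ψ := by
    intro M
    have hM : Matrix.reindex e e M ∈ Submodule.span E (Set.range fun N : Matrix (Fin n) (Fin n) S =>
        Matrix.comp (Fin n) (Fin n) ι ι E (N.map σ)) := by
      rw [Matrix.span_range_comp_map_eq_top σ hσ n]; exact Submodule.mem_top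
    have hM' := Submodule.mem_map_of_mem
      (f := (Matrix.reindexLinearEquiv E E e.symm e.symm).toLinearMap) hM
    rw [Submodule.map_span] at hM'
    have hle : Submodule.span E ((Matrix.reindexLinearEquiv E E e.symm e.symm).toLinearMap ''
        (Set.range fun N : Matrix (Fin n) (Fin n) S =>
        Matrix.comp (Fin n) (Fin n) ι ι E (N.map σ))) ≤ LinearMap.range Ψ.toLinearMap := by
      rw [Submodule.span_le]
      rintro _ ⟨_, ⟨N, rfl⟩, rfl⟩
      exact ⟨1 ⊗ₜ N, by simp [hΨ, hφ]⟩
    obtain ⟨x, hx⟩ := hle hM'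
    refine ⟨x, ?_⟩
    simpa using hx
  have hsplit : IsSplitByClosure K (Matrix (Fin n) (Fin n) S) ∧ Function.Injective Ψ := by
    rcases Nat.eq_zero_or_pos n with rfl | hn
    · -- `M_0(S)` is the zero ring, which is not simple.
      have : Subsingleton (E ⊗[K] Matrix (Fin 0) (Fin 0) S) := by
        refine subsingleton_of_zero_eq_one ?_
        rw [Algebra.TensorProduct.one_def, Subsingleton.elim (1 : Matrix (Fin 0) (Fin 0) S) 0,
          TensorProduct.tmul_zero]
      exact ⟨isSplitByClosure_of_subsingleton _ _, Function.injective_of_subsingleton _⟩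
    · have : NeZero n := ⟨hn.ne'⟩
      have := isSimpleRing_baseChange K (Matrix (Fin n) (Fin n) S) E
      have : Nonempty (Fin (Fintype.card (Fin n × ι))) := ⟨e.symm (0, Classical.arbitrary ι)⟩
      exact ⟨isSplitByClosure_of_isSimpleRing _ _, Ψ.toRingHom.injective⟩
  have hdet : (Ψ (1 ⊗ₜ N)).det = _ :=
    det_eq_csaReducedNorm hsplit.1 N E (AlgEquiv.ofBijective Ψ ⟨hsplit.2, hsurj⟩)
  rw [hΨ, one_smul, hφ, Matrix.det_reindex_self, halg] at hdet
  rw [hτ, hdet]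

/-- A representation of a semisimple algebra whose image spans a full matrix algebra factors
through one of the simple components. -/
theorem WedderburnDecomposition.exists_component_of_span_eq_top {F : Type u} {A : Type v} [Field F]
    [Ring A] [Algebra F A] (W : WedderburnDecomposition F A) {E : Type*} [Field E]
    {ι : Type*} [Fintype ι] [DecidableEq ι] [Nonempty ι] (ρ : A →+* Matrix ι ι E)
    (hρ : Submodule.span E (Set.range ρ) = ⊤) :
    ∃ (j : Fin W.t) (σ : Matrix (Fin (W.d j)) (Fin (W.d j)) (W.D j) →+* Matrix ι ι E),
      ∀ a, ρ a = σ (W.equiv a j) := by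
  -- The images of the central idempotents of `A` are idempotent scalars with sum `1`.
  have hscalar (j : Fin W.t) :
      ∃ c : E, ρ (W.equiv.symm (Pi.single j 1)) = Matrix.scalar ι c := by
    refine Matrix.exists_eq_scalar_of_commute_of_span_eq_top hρ ?_
    rintro _ ⟨a, rfl⟩
    refine Commute.map (f := ρ) (W.equiv.injective ?_)
    rw [map_mul, map_mul, AlgEquiv.apply_symm_apply]
    funext i
    by_cases hij : i = j
    · subst hij; simp
    · simp [hij]
  choose c hc using hscalar
  have hone : ρ (W.equiv.symm (∑ j, Pi.single j 1)) = 1 := by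
    have : (∑ j, Pi.single j 1 : (i : Fin W.t) → Matrix (Fin (W.d i)) (Fin (W.d i)) (W.D i)) = 1 :=
      Finset.univ_sum_single 1
    rw [this, map_one, map_one]
  obtain ⟨j, hj⟩ : ∃ j, c j ≠ 0 := by
    by_contra! h
    rw [map_sum, map_sum] at hone
    simp [hc, h] at hone
  have hj1 : ρ (W.equiv.symm (Pi.single j 1)) = 1 := by
    have hidem : Matrix.scalar ι (c j * c j) = Matrix.scalar ι (c j) := by
      rw [map_mul, ← hc, ← map_mul, ← map_mul, ← Pi.single_mul, mul_one]
    rw [hc, mul_left_cancel₀ hj ((Matrix.scalar_inj.1 hidem).trans (mul_one _).symm), map_one]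
  refine ⟨j, { toFun := fun x => ρ (W.equiv.symm (Pi.single j x))
               map_one' := hj1
               map_mul' := fun x y => by rw [Pi.single_mul, map_mul, map_mul]
               map_zero' := by rw [Pi.single_zero, map_zero, map_zero]
               map_add' := fun x y => by rw [Pi.single_add, map_add, map_add] }, fun a => ?_⟩
  change ρ a = ρ (W.equiv.symm (Pi.single j (W.equiv a j)))
  have : (Pi.single j (W.equiv a j) : (i : Fin W.t) → Matrix (Fin (W.d i)) (Fin (W.d i)) (W.D i)) =
      W.equiv a * Pi.single j 1 := by
    funext i
    by_cases hij : i = j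
    · subst hij; simp
    · simp [hij]
  rw [this, map_mul, map_mul, hj1, mul_one, AlgEquiv.symm_apply_apply]

/-- Under a representation `ρ` whose image spans a full matrix algebra, the reduced norm of `H`
becomes the scalar matrix of the determinant of `ρ(H)`. -/
theorem WedderburnDecomposition.map_reducedNorm {F : Type u} {A : Type v} [Field F] [CharZero F]
    [Ring A] [Algebra F A] [FiniteDimensional F A] (W : WedderburnDecomposition F A) {E : Type v}
    [Field E] {ι : Type*} [Fintype ι] [DecidableEq ι] [Nonempty ι] (ρ : A →+* Matrix ι ι E)
    (hρ : Submodule.span E (Set.range ρ) = ⊤) {n : ℕ} (H : Matrix (Fin n) (Fin n) A) :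
    ρ (W.reducedNorm H : A) =
      Matrix.scalar ι (Matrix.comp (Fin n) (Fin n) ι ι E (H.map ρ)).det := by
  obtain ⟨i, σ, hσ⟩ := W.exists_component_of_span_eq_top ρ hρ
  have : NeZero (W.d i) := ⟨W.d_ne_zero i⟩
  have hfin : Module.Finite F (W.D i) := by
    let f : A →ₗ[F] W.D i := (Matrix.entryLinearMap F (W.D i) 0 0) ∘ₗ
      (LinearMap.proj (φ := fun i => Matrix (Fin (W.d i)) (Fin (W.d i)) (W.D i)) i) ∘ₗ
      W.equiv.toLinearMap
    refine Module.Finite.of_surjective f fun x => ?_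
    exact ⟨W.equiv.symm (Pi.single i (Matrix.of fun _ _ => x)), by simp [f]⟩
  let g : F →+* Subring.center (W.D i) := (algebraMap F (W.D i)).codRestrict _ fun x =>
    Subring.mem_center_iff.2 fun y => (Algebra.commutes x y).symm
  let : Algebra F (Subring.center (W.D i)) := g.toAlgebra
  have : IsScalarTower F (Subring.center (W.D i)) (W.D i) := IsScalarTower.of_algebraMap_eq' rfl
  have : Module.Finite (Subring.center (W.D i)) (W.D i) :=
    Module.Finite.of_restrictScalars_finite F _ _
  have : CharZero (Subring.center (W.D i)) := charZero_of_injective_algebraMap g.injective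
  have : Algebra.IsCentral (Subring.center (W.D i)) (W.D i) :=
    ⟨fun x hx => Algebra.mem_bot.2 ⟨⟨x, hx⟩, rfl⟩⟩
  have hspan : Submodule.span E (Set.range σ) = ⊤ := by
    rw [eq_top_iff, ← hρ]
    refine Submodule.span_mono ?_
    rintro _ ⟨a, rfl⟩
    exact ⟨_, (hσ a).symm⟩
  have hmap : H.map ρ = (W.component H i).map σ := by
    ext1 k l
    exact hσ _
  rw [hmap, ← map_algebraMap_csaReducedNorm (K := Subring.center (W.D i)) σ hspan
    (W.component H i), hσ]
  congr 1
  change W.equiv (W.equiv.symm _) i = _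
  rw [AlgEquiv.apply_symm_apply]
  rfl

/-! ### Valuation rings and integrality -/

/-- Every representation of a finite group over a field `L` can be conjugated into matrices over a
given valuation ring of `L`: finitely generated torsion-free modules over a valuation ring are free,
so that the lattice spanned by the orbit of a basis has a basis. -/
theorem exists_conj_forall_mem_valuationSubring {G : Type*} [Group G] [Finite G] {L : Type*}
    [Field L] (V : ValuationSubring L) {k : ℕ} (ρ : G →* Matrix (Fin k) (Fin k) L) :
    ∃ σ : Matrix (Fin k) (Fin k) L ≃ₐ[L] Matrix (Fin k) (Fin k) L,
      ∀ g i j, σ (ρ g) i j ∈ V := by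
  -- `M` is the lattice spanned by the orbit of the standard basis.
  let s : Set (Fin k → L) := Set.range fun x : G × Fin k => ρ x.1 *ᵥ Pi.single x.2 1
  let M : Submodule V (Fin k → L) := Submodule.span V s
  have hstable (g : G) (m : Fin k → L) (hm : m ∈ M) : ρ g *ᵥ m ∈ M := by
    induction hm using Submodule.span_induction with
    | mem x hx =>
      obtain ⟨⟨h, j⟩, rfl⟩ := hx
      refine Submodule.subset_span ⟨(g * h, j), ?_⟩
      simp only [map_mul, Matrix.mulVec_mulVec]
    | zero => simp
    | add x y _ _ hx hy => rw [Matrix.mulVec_add]; exact M.add_mem hx hy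
    | smul a x _ hx => rw [Matrix.mulVec_smul]; exact M.smul_mem a hx
  have : Module.Finite V M := Module.Finite.span_of_finite V (Set.finite_range _)
  have : Module.IsTorsionFree V (Fin k → L) := inferInstance
  have : Module.Flat V M := by
    rw [Module.Flat.flat_iff_torsion_eq_bot_of_isBezout,
      ← Submodule.isTorsionFree_iff_torsion_eq_bot]
    infer_instance
  have : Module.Free V M := Module.free_of_flat_of_isLocalRing
  let b := Module.Free.chooseBasis V M
  have hli : LinearIndependent L fun i => (b i : Fin k → L) := by
    rw [← LinearIndependent.iff_fractionRing V L]
    exact b.linearIndependent.map' M.subtype M.ker_subtype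
  have hMle (m : Fin k → L) (hm : m ∈ M) :
      m ∈ Submodule.span L (Set.range fun i => (b i : Fin k → L)) := by
    have := congrArg M.subtype (b.sum_repr ⟨m, hm⟩)
    rw [map_sum] at this
    change _ = m at this
    rw [← this]
    refine Submodule.sum_mem _ fun i _ => ?_
    rw [map_smul]
    exact Submodule.smul_mem _ (b.repr ⟨m, hm⟩ i : L) (Submodule.subset_span ⟨i, rfl⟩)
  have hspan : ⊤ ≤ Submodule.span L (Set.range fun i => (b i : Fin k → L)) := by
    rw [← (Pi.basisFun L (Fin k)).span_eq, Submodule.span_le]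
    rintro _ ⟨j, rfl⟩
    exact hMle _ (Submodule.subset_span ⟨(1, j), by
      simp only [map_one, Matrix.one_mulVec, Pi.basisFun_apply]⟩)
  let b₁ := Module.Basis.mk hli hspan
  let e := b₁.indexEquiv (Pi.basisFun L (Fin k))
  refine ⟨Matrix.toLinAlgEquiv'.trans (LinearMap.toMatrixAlgEquiv (b₁.reindex e)),
    fun g i j => ?_⟩
  have hmem : ρ g *ᵥ (b (e.symm j) : Fin k → L) ∈ M := hstable g _ (b _).2
  have hrepr : ρ g *ᵥ (b (e.symm j) : Fin k → L) =
      ∑ l, (b.repr ⟨_, hmem⟩ l : L) • b₁ l := by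
    have := congrArg M.subtype (b.sum_repr ⟨_, hmem⟩)
    rw [map_sum] at this
    refine this.symm.trans (Finset.sum_congr rfl fun l _ => ?_)
    rw [map_smul, Module.Basis.mk_apply]
    rfl
  have : (Matrix.toLinAlgEquiv'.trans (LinearMap.toMatrixAlgEquiv (b₁.reindex e))) (ρ g) i j =
      (b.repr ⟨_, hmem⟩ (e.symm i) : L) := by
    rw [AlgEquiv.trans_apply, LinearMap.toMatrixAlgEquiv_apply, Matrix.toLinAlgEquiv'_apply,
      Module.Basis.reindex_apply, Module.Basis.repr_reindex_apply, Module.Basis.mk_apply]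
    conv_lhs => rw [hrepr, map_sum]
    simp [Finsupp.single_apply]
  rw [this]
  exact SetLike.coe_mem _

theorem isIntegral_of_forall_mem_valuationSubring {R L : Type*} [CommRing R] [Field L]
    [Algebra R L] {x : L}
    (h : ∀ V : ValuationSubring L, (∀ r : R, algebraMap R L r ∈ V) → x ∈ V) : IsIntegral R x := by
  by_contra hx
  obtain ⟨V, hV, hxV⟩ := Subring.exists_le_valuationSubring_of_isIntegrallyClosedIn
    (R := (integralClosure R L).toSubring) hx
  exact hxV (h V fun r => hV (algebraMap_mem (integralClosure R L) r))

theorem Matrix.det_mem_subring {B m : Type*} [CommRing B] [Fintype m] [DecidableEq m]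
    (S : Subring B) {M : Matrix m m B} (hM : ∀ i j, M i j ∈ S) : M.det ∈ S := by
  rw [Matrix.det_apply]
  refine S.sum_mem fun σ _ => ?_
  rw [Units.smul_def]
  exact S.zsmul_mem (S.prod_mem fun i _ => hM _ _) _

/-! ### The tautological twist of a representation -/

/-- Homomorphisms to an algebraically closed field separate the points of a finite-dimensional
semisimple commutative algebra. -/
theorem exists_algHom_ne_zero {L B : Type*} [Field L] [IsAlgClosed L] [CommRing B] [Algebra L B]
    [FiniteDimensional L B] [IsSemisimpleRing B] {b : B} (hb : b ≠ 0) :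
    ∃ χ : B →ₐ[L] L, χ b ≠ 0 := by
  have hj : b ∉ Ideal.jacobson (⊥ : Ideal B) := by
    rw [Ideal.jacobson_bot, IsSemisimpleRing.jacobson_eq_bot]
    exact hb
  obtain ⟨m, hm, hbm⟩ : ∃ m : Ideal B, m.IsMaximal ∧ b ∉ m := by
    simpa [Ideal.jacobson, Ideal.mem_sInf] using hj
  let : Field (B ⧸ m) := Ideal.Quotient.field m
  let f : L ≃ₐ[L] B ⧸ m := AlgEquiv.ofBijective (Algebra.ofId L _)
    IsAlgClosed.algebraMap_bijective_of_isIntegral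
  refine ⟨f.symm.toAlgHom.comp (Ideal.Quotient.mkₐ L m), fun h => hbm ?_⟩
  have : f.symm (Ideal.Quotient.mk m b) = 0 := h
  rwa [map_eq_zero_iff _ f.symm.injective, Ideal.Quotient.eq_zero_iff_mem] at this

theorem MonoidAlgebra.lift_eq_sum {F A G : Type*} [CommSemiring F] [Semiring A] [Algebra F A]
    [Monoid G] [Fintype G] (ρ : G →* A) (x : MonoidAlgebra F G) :
    MonoidAlgebra.lift F A G ρ x = ∑ g, x.coeff g • ρ g := by
  rw [MonoidAlgebra.lift_apply, Finsupp.sum_fintype _ _ fun g => by simp]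

/-- The tensor product of a matrix representation `ρ` of `G` over `L` with the tautological
character `G → L[G/G']ˣ`. -/
noncomputable def twistByAbelianization {G L ι : Type*} [Group G] [CommRing L] [Fintype ι]
    [DecidableEq ι] (ρ : G →* Matrix ι ι L) :
    G →* Matrix ι ι (MonoidAlgebra L (Abelianization G)) where
  toFun g := (ρ g).map (MonoidAlgebra.single (Abelianization.of g))
  map_one' := by
    ext1 i j
    by_cases hij : i = j <;> simp [Matrix.one_apply, hij, MonoidAlgebra.one_def]
  map_mul' g h := by
    ext1 i j
    simp only [map_mul, Matrix.mul_apply, Matrix.map_apply, MonoidAlgebra.single_mul_single]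
    exact map_sum (MonoidAlgebra.singleAddHom _) _ _

theorem twistByAbelianization_apply {G L ι : Type*} [Group G] [CommRing L] [Fintype ι]
    [DecidableEq ι] (ρ : G →* Matrix ι ι L) (g : G) (i j : ι) :
    twistByAbelianization ρ g i j = MonoidAlgebra.single (Abelianization.of g) (ρ g i j) := rfl

theorem lift_twistByAbelianization_apply {G F L ι : Type*} [Group G] [Fintype G] [Field F]
    [Field L] [Algebra F L] [Fintype ι] [DecidableEq ι] (ρ : G →* Matrix ι ι L)
    (x : MonoidAlgebra F G) (i j : ι) :
    MonoidAlgebra.lift F _ G (twistByAbelianization ρ) x i j =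
      ∑ g, MonoidAlgebra.single (Abelianization.of g)
        (algebraMap F L (x.coeff g) * ρ g i j) := by
  rw [MonoidAlgebra.lift_eq_sum, Matrix.sum_apply]
  refine Finset.sum_congr rfl fun g _ => ?_
  rw [Matrix.smul_apply, twistByAbelianization_apply, MonoidAlgebra.smul_single, Algebra.smul_def]

section

variable {G : Type w} [Group G] [Finite G] {F : Type u} [Field F] [CharZero F]
  {L : Type (max u w)} [Field L] [Algebra F L] {ι : Type*} [Fintype ι] [DecidableEq ι] [Nonempty ι]

theorem lift_reducedNorm (ρ : G →* Matrix ι ι L) (hρ : Submodule.span L (Set.range ρ) = ⊤) {n : ℕ}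
    (H : Matrix (Fin n) (Fin n) (MonoidAlgebra F G)) :
    MonoidAlgebra.lift F _ G ρ (reducedNorm F H : MonoidAlgebra F G) =
      Matrix.scalar ι (Matrix.comp _ _ _ _ _ (H.map (MonoidAlgebra.lift F _ G ρ))).det := by
  refine WedderburnDecomposition.map_reducedNorm _
    (MonoidAlgebra.lift F (Matrix ι ι L) G ρ).toRingHom ?_ H
  rw [eq_top_iff, ← hρ]
  refine Submodule.span_mono ?_
  rintro _ ⟨g, rfl⟩
  exact ⟨MonoidAlgebra.single g 1, by simp⟩

/-- The analogue of `lift_reducedNorm` for the twist of `ρ` by the tautological character. The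
`L`-algebra `L[G/G']` is separated by its homomorphisms to `L`, and those turn the tautological
twist of `ρ` into the twists of `ρ` by the linear characters of `G`. -/
theorem lift_twistByAbelianization_reducedNorm [IsAlgClosed L] (ρ : G →* Matrix ι ι L)
    (hρ : Submodule.span L (Set.range ρ) = ⊤) {n : ℕ}
    (H : Matrix (Fin n) (Fin n) (MonoidAlgebra F G)) :
    MonoidAlgebra.lift F _ G (twistByAbelianization ρ) (reducedNorm F H : MonoidAlgebra F G) =
      Matrix.scalar ι (Matrix.comp _ _ _ _ _
        (H.map (MonoidAlgebra.lift F _ G (twistByAbelianization ρ)))).det := by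
  have : CharZero L := charZero_of_injective_algebraMap (algebraMap F L).injective
  have : NeZero (Nat.card (Abelianization G) : L) := ⟨by simp [Nat.card_pos.ne']⟩
  set Δ := MonoidAlgebra.lift F _ G (twistByAbelianization ρ) with hΔ
  ext1 i j
  by_contra hne
  obtain ⟨χ, hχ⟩ := exists_algHom_ne_zero (L := L) (sub_ne_zero.2 hne)
  -- `ρχ` is the twist of `ρ` by the linear character `g ↦ χ(ḡ)`.
  let ρχ : G →* Matrix ι ι L :=
    ((χ.mapMatrix (m := ι)).toRingHom.toMonoidHom).comp (twistByAbelianization ρ)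
  have hρχ (g : G) : ρχ g = χ (MonoidAlgebra.single (Abelianization.of g) 1) • ρ g := by
    ext1 k l
    change χ (twistByAbelianization ρ g k l) = _
    rw [twistByAbelianization_apply, Matrix.smul_apply, smul_eq_mul, mul_comm,
      ← smul_eq_mul, ← map_smul, MonoidAlgebra.smul_single, smul_eq_mul, mul_one]
  have hunit (g : G) : χ (MonoidAlgebra.single (Abelianization.of g) 1) ≠ 0 := by
    have : IsUnit (MonoidAlgebra.single (Abelianization.of g) (1 : L)) :=
      (Group.isUnit (Abelianization.of g)).map (MonoidAlgebra.of L (Abelianization G))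
    exact (this.map χ).ne_zero
  have hspan : Submodule.span L (Set.range ρχ) = ⊤ := by
    rw [eq_top_iff, ← hρ, Submodule.span_le]
    rintro _ ⟨g, rfl⟩
    have h := Submodule.smul_mem (Submodule.span L (Set.range ρχ))
      (χ (MonoidAlgebra.single (Abelianization.of g) 1))⁻¹ (Submodule.subset_span ⟨g, rfl⟩)
    rwa [hρχ, inv_smul_smul₀ (hunit g)] at h
  have hmap (x : MonoidAlgebra F G) :
      (Δ x).map χ = MonoidAlgebra.lift F (Matrix ι ι L) G ρχ x := by
    have : ((χ.restrictScalars F).mapMatrix (m := ι)).comp Δ =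
        MonoidAlgebra.lift F (Matrix ι ι L) G ρχ := by
      refine (MonoidAlgebra.lift F (Matrix ι ι L) G).symm.injective (MonoidHom.ext fun g => ?_)
      simp [Δ, ρχ]
    exact DFunLike.congr_fun this x
  have key := lift_reducedNorm ρχ hspan H
  have hdet : χ (Matrix.comp _ _ _ _ _ (H.map Δ)).det =
      (Matrix.comp _ _ _ _ _ (H.map (MonoidAlgebra.lift F _ G ρχ))).det := by
    rw [AlgHom.map_det]
    congr 1
    ext1 ⟨a, b⟩ ⟨c, d⟩
    exact congrFun (congrFun (hmap (H a c)) b) d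
  apply hχ
  rw [map_sub, sub_eq_zero]
  have h1 := congrFun (congrFun ((hmap (reducedNorm F H : MonoidAlgebra F G)).trans key) i) j
  rw [← hdet, Matrix.map_apply] at h1
  rw [h1]
  by_cases hij : i = j <;> simp [hij, Matrix.scalar_apply]

end

/-! ### Integrality of the coset parts of reduced norms -/

section

open Classical in
/-- The coefficient at `t` of the tautological twist picks out the part of `x` supported on the
coset `t` of the commutator subgroup. -/
theorem coeff_lift_twistByAbelianization {G F L ι : Type*} [Group G] [Fintype G] [Field F]
    [Field L] [Algebra F L] [Fintype ι] [DecidableEq ι] (ρ : G →* Matrix ι ι L)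
    (x : MonoidAlgebra F G) (t : Abelianization G) (i j : ι) :
    (MonoidAlgebra.lift F _ G (twistByAbelianization ρ) x i j).coeff t =
      (∑ g with Abelianization.of g = t, algebraMap F L (x.coeff g) • ρ g) i j := by
  rw [lift_twistByAbelianization_apply, MonoidAlgebra.coeff_sum, Finset.sum_filter,
    Matrix.sum_apply, Finsupp.finsetSum_apply]
  refine Finset.sum_congr rfl fun g _ => ?_
  rw [MonoidAlgebra.coeff_single, Finsupp.single_apply]
  split_ifs <;> simp

variable {G : Type w} [Group G] [Fintype G] {F : Type u} [Field F] {L : Type (max u w)} [Field L]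
  [Algebra F L] {R : Type v} [CommRing R] [Algebra R F] [Algebra R L] [IsScalarTower R F L]

/-- If `ρ` and `H` have entries in `V`, then the determinant lies in `V[G/G']`. -/
theorem coeff_det_lift_twistByAbelianization_mem (V : Subring L)
    (hV : ∀ r : R, algebraMap R L r ∈ V) {ι : Type*} [Fintype ι] [DecidableEq ι]
    (ρ : G →* Matrix ι ι L) (hρ : ∀ g i j, ρ g i j ∈ V) {n : ℕ}
    (H : Matrix (Fin n) (Fin n) (MonoidAlgebra R G)) (t : Abelianization G) :
    (Matrix.comp _ _ _ _ _ ((H.map (groupRingMap R F G)).map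
      (MonoidAlgebra.lift F _ G (twistByAbelianization ρ)))).det.coeff t ∈ V := by
  let S : Subring (MonoidAlgebra L (Abelianization G)) :=
    (MonoidAlgebra.mapRingHom (Abelianization G) V.subtype).range
  suffices h : (Matrix.comp _ _ _ _ _ ((H.map (groupRingMap R F G)).map
      (MonoidAlgebra.lift F _ G (twistByAbelianization ρ)))).det ∈ S by
    obtain ⟨y, hy⟩ := h
    rw [← hy, MonoidAlgebra.coeff_mapRingHom]
    exact (y.coeff t).2
  refine Matrix.det_mem_subring S fun ⟨a, i⟩ ⟨b, j⟩ => ?_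
  change MonoidAlgebra.lift F _ G (twistByAbelianization ρ) (groupRingMap R F G (H a b)) i j ∈ S
  rw [lift_twistByAbelianization_apply]
  refine S.sum_mem fun g _ => ?_
  have hmem : algebraMap F L ((groupRingMap R F G (H a b)).coeff g) * ρ g i j ∈ V := by
    refine V.mul_mem ?_ (hρ g i j)
    rw [groupRingMap, MonoidAlgebra.coeff_mapRingHom, ← IsScalarTower.algebraMap_apply]
    exact hV _
  exact ⟨MonoidAlgebra.single (Abelianization.of g) ⟨_, hmem⟩, by simp⟩

open Classical in
/-- Under an absolutely irreducible representation `ρ`, the part of the reduced norm of `H` that is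
supported on a coset of the commutator subgroup becomes a scalar, and this scalar is integral: it
is a coefficient of the determinant of `H` under the tautological twist of `ρ`, and for each
valuation ring `V` containing `R` one may compute it after conjugating `ρ` into matrices
over `V`. -/
theorem exists_isIntegral_sum_groupRingNorm_eq_scalar [CharZero F] [IsAlgClosed L]
    {k : ℕ} [NeZero k] (ρ : G →* Matrix (Fin k) (Fin k) L)
    (hρ : Submodule.span L (Set.range ρ) = ⊤) {n : ℕ}
    (H : Matrix (Fin n) (Fin n) (MonoidAlgebra R G)) (t : Abelianization G) :
    ∃ a : L, IsIntegral R a ∧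
      ∑ g with Abelianization.of g = t,
        algebraMap F L ((groupRingNorm F H : MonoidAlgebra F G).coeff g) • ρ g =
      Matrix.scalar (Fin k) a := by
  have hsum (ρ : G →* Matrix (Fin k) (Fin k) L) (hρ : Submodule.span L (Set.range ρ) = ⊤) :
      ∑ g with Abelianization.of g = t,
        algebraMap F L ((groupRingNorm F H : MonoidAlgebra F G).coeff g) • ρ g =
      Matrix.scalar (Fin k) ((Matrix.comp _ _ _ _ _ ((H.map (groupRingMap R F G)).map
        (MonoidAlgebra.lift F _ G (twistByAbelianization ρ)))).det.coeff t) := by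
    ext1 i j
    rw [← coeff_lift_twistByAbelianization, groupRingNorm,
      lift_twistByAbelianization_reducedNorm ρ hρ]
    by_cases hij : i = j <;> simp [hij, Matrix.scalar_apply]
  refine ⟨_, isIntegral_of_forall_mem_valuationSubring fun V hV => ?_, hsum ρ hρ⟩
  obtain ⟨σ, hσ⟩ := exists_conj_forall_mem_valuationSubring V ρ
  let ρ' : G →* Matrix (Fin k) (Fin k) L := (σ : _ →* Matrix (Fin k) (Fin k) L).comp ρ
  have hρ' : Submodule.span L (Set.range ρ') = ⊤ := by
    have := congrArg (Submodule.map σ.toLinearMap) hρ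
    rw [Submodule.map_span, ← Set.range_comp, Submodule.map_top,
      LinearMap.range_eq_top.2 σ.surjective] at this
    exact this
  have h1 := congrArg σ (hsum ρ hρ)
  have h2 := hsum ρ' hρ'
  have h3 (a : L) : σ (Matrix.scalar (Fin k) a) = Matrix.scalar (Fin k) a := σ.commutes a
  rw [h3, map_sum] at h1
  simp_rw [map_smul] at h1
  rw [Matrix.scalar_inj.1 (h1.symm.trans h2)]
  exact coeff_det_lift_twistByAbelianization_mem V.toSubring hV ρ' hσ H t

end

/-! ### Traces and representations of group algebras -/

theorem MonoidAlgebra.trace_lmul {L K : Type*} [CommRing L] [Group K] [Finite K]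
    (y : MonoidAlgebra L K) :
    LinearMap.trace L _ (Algebra.lmul L (MonoidAlgebra L K) y) = Nat.card K • y.coeff 1 := by
  classical
  have := Fintype.ofFinite K
  rw [LinearMap.trace_eq_matrix_trace L (MonoidAlgebra.basis K L), Matrix.trace]
  have h (k : K) : LinearMap.toMatrix (MonoidAlgebra.basis K L) (MonoidAlgebra.basis K L)
      (Algebra.lmul L (MonoidAlgebra L K) y) k k = y.coeff 1 := by
    rw [LinearMap.toMatrix_apply]
    have h1 : MonoidAlgebra.basis K L k = MonoidAlgebra.single k (1 : L) := by simp
    have h2 : (y * MonoidAlgebra.single k (1 : L)).coeff k = y.coeff 1 := by simp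
    rw [h1]
    exact h2
  rw [Finset.sum_congr rfl fun k _ => (Matrix.diag_apply _ k).trans (h k), Finset.sum_const,
    Finset.card_univ, Nat.card_eq_fintype_card]

theorem Module.End.isIntegral_trace_of_forall_hasEigenvalue {R L V : Type*} [CommRing R] [Field L]
    [IsAlgClosed L] [Algebra R L] [AddCommGroup V] [Module L V] [FiniteDimensional L V]
    (f : Module.End L V) (h : ∀ μ, f.HasEigenvalue μ → IsIntegral R μ) :
    IsIntegral R (LinearMap.trace L V f) := by
  rw [Module.End.trace_eq_sum_roots_charpoly_of_splits (IsAlgClosed.splits _)]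
  refine IsIntegral.multiset_sum fun μ hμ => h μ ?_
  rw [Module.End.hasEigenvalue_iff_isRoot_charpoly]
  exact Polynomial.isRoot_of_mem_roots hμ

/-- Over an algebraically closed field `L`, the elements of the group algebra of `G` are separated
by absolutely irreducible matrix representations of `G`. -/
theorem exists_representation_span_eq_top {G L : Type*} [Group G] [Finite G] [Field L] [CharZero L]
    [IsAlgClosed L] {v : MonoidAlgebra L G} (hv : v ≠ 0) :
    ∃ (k : ℕ) (_ : NeZero k) (ρ : G →* Matrix (Fin k) (Fin k) L),
      Submodule.span L (Set.range ρ) = ⊤ ∧ MonoidAlgebra.lift L _ G ρ v ≠ 0 := by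
  have : NeZero (Nat.card G : L) := ⟨by simp [Nat.card_pos.ne']⟩
  obtain ⟨n, d, hd, ⟨e⟩⟩ :=
    IsSemisimpleRing.exists_algEquiv_pi_matrix_of_isAlgClosed L (MonoidAlgebra L G)
  obtain ⟨i, hi⟩ : ∃ i, e v i ≠ 0 := by
    by_contra! h
    exact hv (e.injective (by rw [map_zero]; exact funext h))
  let π : MonoidAlgebra L G →ₐ[L] Matrix (Fin (d i)) (Fin (d i)) L :=
    (Pi.evalAlgHom L (fun i => Matrix (Fin (d i)) (Fin (d i)) L) i).comp e.toAlgHom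
  have hπ : Function.Surjective π := fun M => ⟨e.symm (Pi.single i M), by simp [π]⟩
  refine ⟨d i, hd i, (MonoidAlgebra.lift L _ G).symm π, ?_, ?_⟩
  · have h := congrArg (Submodule.map π.toLinearMap) (MonoidAlgebra.basis G L).span_eq
    rw [Submodule.map_span, ← Set.range_comp, Submodule.map_top,
      LinearMap.range_eq_top.2 hπ] at h
    rw [← h]
    congr 2
  · rw [Equiv.apply_symm_apply]
    exact hi

/-! ### Denominators of reduced norms -/

section

variable {G : Type w} [Group G] [Finite G] {F : Type u} [Field F] [CharZero F]
  {R : Type v} [CommRing R] [Algebra R F]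

/-- The coefficient of `z = nr(H)` at `g`, times `|G'|`, is the trace of left multiplication by
`y = ∑ h : G', z(gh) h` on `L[G']`. The element `g y` is the part of `z` supported on `g G'`; it is
a scalar integral over `R` in each absolutely irreducible representation `ρ` of `G`. So an
eigenvalue `μ` of `y` satisfies `μ ^ m = a ^ m` for one of these scalars `a` and the order `m`
of `g`. -/
theorem isIntegral_card_commutator_smul_coeff_groupRingNorm {n : ℕ}
    (H : Matrix (Fin n) (Fin n) (MonoidAlgebra R G)) (g : G) :
    IsIntegral R
      (Nat.card (commutator G) • (groupRingNorm F H : MonoidAlgebra F G).coeff g) := by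
  classical
  have := Fintype.ofFinite G
  -- The definition of reduced norms asks for a splitting field in the universe of `F[G]`.
  let L := AlgebraicClosure (ULift.{w} F)
  have : CharZero L := charZero_of_injective_algebraMap (algebraMap F L).injective
  set z := (groupRingNorm F H : MonoidAlgebra F G)
  let y : MonoidAlgebra L (commutator G) :=
    ∑ h : commutator G, MonoidAlgebra.single h (algebraMap F L (z.coeff (g * h)))
  have hy (h : commutator G) : y.coeff h = algebraMap F L (z.coeff (g * h)) := by
    simp [y, MonoidAlgebra.coeff_sum, Finsupp.finsetSum_apply, Finsupp.single_apply]
  have htrace : LinearMap.trace L _ (Algebra.lmul L (MonoidAlgebra L (commutator G)) y) =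
      algebraMap F L (Nat.card (commutator G) • z.coeff g) := by
    rw [MonoidAlgebra.trace_lmul, hy, OneMemClass.coe_one, mul_one, map_nsmul]
  rw [← isIntegral_algebraMap_iff (algebraMap F L).injective, ← htrace]
  refine Module.End.isIntegral_trace_of_forall_hasEigenvalue _ fun μ hμ => ?_
  obtain ⟨v, hv⟩ := hμ.exists_hasEigenvector
  have hyv : y * v = μ • v := hv.apply_eq_smul
  have hv' : MonoidAlgebra.mapDomainAlgHom L L (commutator G).subtype v ≠ 0 := by
    intro h0
    refine hv.2 (MonoidAlgebra.mapDomain_injective (commutator G).subtype_injective ?_)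
    exact h0.trans (map_zero (MonoidAlgebra.mapDomainAlgHom L L (commutator G).subtype)).symm
  obtain ⟨k, _, ρ, hρ, hρv⟩ := exists_representation_span_eq_top hv'
  let τ := MonoidAlgebra.lift L _ (commutator G) (ρ.comp (commutator G).subtype)
  have hτ : (MonoidAlgebra.lift L _ G ρ).comp
      (MonoidAlgebra.mapDomainAlgHom L L (commutator G).subtype) = τ := by
    refine (MonoidAlgebra.lift L _ (commutator G)).symm.injective (MonoidHom.ext fun h => ?_)
    simp [τ]
  have hτv : τ v ≠ 0 := by rw [← hτ]; exact hρv
  obtain ⟨a, ha, hsum⟩ :=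
    exists_isIntegral_sum_groupRingNorm_eq_scalar (F := F) ρ hρ H (Abelianization.of g)
  have hscalar : ρ g * τ y = Matrix.scalar (Fin k) a := by
    rw [← hsum, MonoidAlgebra.lift_eq_sum, Finset.mul_sum]
    have hker (x : G) : Abelianization.of (g * x) = Abelianization.of g ↔ x ∈ commutator G := by
      rw [map_mul, mul_eq_left, ← MonoidHom.mem_ker, Abelianization.ker_of]
    rw [Finset.sum_filter, ← Equiv.sum_comp (Equiv.mulLeft g), ← Finset.sum_filter]
    simp only [Equiv.coe_mulLeft, hker]
    rw [Finset.sum_subtype (p := fun x => x ∈ commutator G) _ (fun x => by simp)]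
    refine Finset.sum_congr rfl fun h _ => ?_
    rw [hy, mul_smul_comm, MonoidHom.comp_apply, Subgroup.subtype_apply, map_mul ρ]
  have hone : a • τ v = μ • (ρ g * τ v) := by
    have h1 : τ y * τ v = μ • τ v := by rw [← map_mul, hyv, map_smul]
    have h2 : Matrix.scalar (Fin k) a * τ v = a • τ v := by
      rw [Matrix.scalar_apply, ← Matrix.smul_eq_diagonal_mul]
    rw [← h2, ← hscalar, mul_assoc, h1, mul_smul_comm]
  have hpow (m : ℕ) : a ^ m • τ v = μ ^ m • (ρ g ^ m * τ v) := by
    induction m with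
    | zero => simp
    | succ m ih =>
      rw [pow_succ', mul_smul, ih, smul_comm, ← mul_smul_comm, hone, mul_smul_comm, smul_smul,
        ← pow_succ, ← mul_assoc, ← pow_succ]
  have hμa : a ^ orderOf g = μ ^ orderOf g := by
    have h := hpow (orderOf g)
    rw [← map_pow, pow_orderOf_eq_one, map_one, one_mul] at h
    exact smul_left_injective L hτv h
  exact IsIntegral.of_pow (orderOf_pos g) (hμa ▸ ha.pow _)

theorem card_commutator_smul_groupRingNorm_mem [IsIntegrallyClosed R] [IsFractionRing R F] {n : ℕ}
    (H : Matrix (Fin n) (Fin n) (MonoidAlgebra R G)) :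
    Nat.card (commutator G) • (groupRingNorm F H : MonoidAlgebra F G) ∈
      groupRingCenter R F G := by
  have := Fintype.ofFinite G
  have hinj : Function.Injective (groupRingMap R F G) := by
    intro x y hxy
    ext g
    refine IsFractionRing.injective R F ?_
    have := congrArg (fun x => x.coeff g) hxy
    simpa only [groupRingMap, MonoidAlgebra.coeff_mapRingHom] using this
  have hint (g : G) : ∃ r : R, algebraMap R F r =
      Nat.card (commutator G) • (groupRingNorm F H : MonoidAlgebra F G).coeff g :=
    IsIntegrallyClosed.isIntegral_iff.1 (isIntegral_card_commutator_smul_coeff_groupRingNorm H g)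
  choose r hr using hint
  have hx : groupRingMap R F G (∑ g, MonoidAlgebra.single g (r g)) =
      Nat.card (commutator G) • (groupRingNorm F H : MonoidAlgebra F G) := by
    classical
    ext g
    rw [groupRingMap, MonoidAlgebra.coeff_mapRingHom, MonoidAlgebra.coeff_sum,
      Finsupp.finsetSum_apply]
    simp only [MonoidAlgebra.coeff_single, Finsupp.single_apply, Finset.sum_ite_eq',
      Finset.mem_univ, if_true, hr]
    rfl
  refine ⟨_, Subring.mem_center_iff.2 fun y => hinj ?_, hx⟩
  rw [map_mul, map_mul, hx]
  exact Subring.mem_center_iff.1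
    ((Subring.center (MonoidAlgebra F G)).nsmul_mem (groupRingNorm F H).2 _) _

theorem card_commutator_smul_mem_of_mem_integralityRing [IsIntegrallyClosed R] [IsFractionRing R F]
    {x : MonoidAlgebra F G} (hx : x ∈ integralityRing R F G) :
    Nat.card (commutator G) • x ∈ groupRingCenter R F G := by
  induction hx using Submodule.span_induction with
  | mem x hx =>
    obtain ⟨n, H, rfl⟩ := hx
    exact card_commutator_smul_groupRingNorm_mem H
  | zero => simp
  | add x y _ _ hx hy =>
    rw [smul_add]
    exact (groupRingCenter R F G).add_mem hx hy
  | smul c x _ hx =>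
    rw [smul_comm]
    exact (groupRingCenter R F G).mul_mem c.2 hx

end

theorem mainTheorem4 (G : Type w) [Group G] [Finite G] :
    -- the bound for every admissible coefficient ring `R ⊂ F`, `F / ℚ_p`
    (∀ (p : ℕ) [Fact p.Prime] (F : Type u) [Field F] [CharZero F] [Algebra ℚ_[p] F]
        (R : Type v) [CommRing R] [IsNoetherianRing R] [IsIntegrallyClosed R] [Algebra R F]
        [IsFractionRing R F] (n : ℕ) (H : Matrix (Fin n) (Fin n) (MonoidAlgebra R G)),
        Nat.card (commutator G) • (groupRingNorm F H : MonoidAlgebra F G) ∈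
          groupRingCenter R F G) ∧
    -- `|G'| I(G) ⊆ ζ(ℤ[G])`
    (∀ x ∈ integralityRing ℤ ℚ G, Nat.card (commutator G) • x ∈ groupRingCenter ℤ ℚ G) ∧
    -- `|G'| I_p(G) ⊆ ζ(ℤ_p[G])`
    (∀ (p : ℕ) [Fact p.Prime], ∀ x ∈ integralityRing ℤ_[p] ℚ_[p] G,
        Nat.card (commutator G) • x ∈ groupRingCenter ℤ_[p] ℚ_[p] G) :=
  ⟨fun _ _ _ _ _ _ _ _ _ _ _ _ _ H => card_commutator_smul_groupRingNorm_mem H,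
    fun _ hx => card_commutator_smul_mem_of_mem_integralityRing hx,
    fun _ _ _ hx => card_commutator_smul_mem_of_mem_integralityRing hx⟩
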